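/- Let $X$ be a metrizable topological space and $Y$ a regular topological space. A subset $E\subseteq X$ is called resolvable if there is a decreasing (not necessarily strictly) transfinite sequence $\langle F_\xi\rangle$ of closed subsets of $X$ with $$E=(F_0\setminus F_1)\cup(F_2\setminus F_3)\cup\dots\cup(F_\xi\setminus F_{\xi+1})\cup\cdots,$$ where $\xi$ runs over the even ordinals (those of the form $\lambda+2n$ with $n<\omega$ and $\lambda$ zero or a limit ordinal). A map $f\colon X\to Y$ is called resolvable-measurable if $f^{-1}(U)$ is a resolvable subset of $X$ for every open set $U\subseteq Y$. Then every resolvable-measurable map $f\colon X\to Y$ is piecewise continuous, i.e. there are closed sets $X_0,X_1,\dots\subseteq X$ with $X=\bigcup_{n\in\omega}X_n$ such that the restriction $f\upharpoonright X_n$ is continuous for every $n\in\omega$. -/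

import Mathlib

universe u v

/-- A subset `E` of a topological space is resolvable if
`E = (F₀ \ F₁) ∪ (F₂ \ F₃) ∪ … ∪ (F_ξ \ F_{ξ+1}) ∪ …`, `ξ` ranging over the even ordinals, for a
decreasing (not necessarily strictly) transfinite sequence of closed sets. The even ordinals
(limit ordinals plus even naturals) are exactly the ordinals `2 * η`; in particular `2 * ω = ω`.
A sequence of some ordinal length is extended by `∅` to all ordinals; conversely a decreasing
family of subsets of `X : Type u` indexed by `Ordinal.{u}` is eventually constant, so only a
set-sized initial part of it matters. -/
def IsResolvableSet {X : Type u} [TopologicalSpace X] (E : Set X) : Prop :=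
  ∃ F : Ordinal.{u} → Set X, Antitone F ∧ (∀ ξ, IsClosed (F ξ)) ∧
    E = ⋃ η : Ordinal.{u}, F (2 * η) \ F (2 * η + 1)

/-- Preimages of open sets are resolvable. -/
def ResolvableMeasurable {X : Type u} {Y : Type v} [TopologicalSpace X] [TopologicalSpace Y]
    (f : X → Y) : Prop :=
  ∀ U : Set Y, IsOpen U → IsResolvableSet (f ⁻¹' U)

/-- The domain is covered by a sequence of closed sets on each of which `f` is continuous. -/
def PiecewiseContinuous {X : Type u} {Y : Type v} [TopologicalSpace X] [TopologicalSpace Y]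
    (f : X → Y) : Prop :=
  ∃ C : ℕ → Set X, (∀ n, IsClosed (C n)) ∧ (⋃ n, C n) = Set.univ ∧ ∀ n, ContinuousOn f (C n)

open Set Topology

/-! ### Resolvable sets -/

/-- A nonempty set cannot be split into two pieces, both dense in it, by a resolvable set. -/
lemma IsResolvableSet.eq_empty_of_dense_codense {X : Type u} [TopologicalSpace X] {E A : Set X}
    (hE : IsResolvableSet E) (h₁ : A ⊆ closure (A ∩ E)) (h₂ : A ⊆ closure (A \ E)) : A = ∅ := by
  obtain ⟨F, hF, hcl, rfl⟩ := hE
  set E := ⋃ η : Ordinal.{u}, F (2 * η) \ F (2 * η + 1) with hE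
  have key : ∀ η : Ordinal.{u}, A ⊆ F (2 * η + 1) := by
    intro η
    induction η using WellFoundedLT.induction with
    | ind η ih =>
      have h0 : A ⊆ F (2 * η) := by
        refine h₁.trans (closure_minimal ?_ (hcl _))
        rintro x ⟨hxA, hxE⟩
        obtain ⟨ζ, hx1, hx2⟩ := mem_iUnion.1 hxE
        have : η ≤ ζ := by
          by_contra hlt
          exact hx2 (ih ζ (not_le.1 hlt) hxA)
        exact hF (mul_le_mul_right this 2) hx1
      refine h₂.trans (closure_minimal ?_ (hcl _))
      rintro x ⟨hxA, hxE⟩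
      by_contra hx
      exact hxE (mem_iUnion.2 ⟨η, h0 hxA, hx⟩)
  have hAE : A ∩ E = ∅ := by
    refine eq_empty_of_forall_notMem ?_
    rintro x ⟨hxA, hxE⟩
    obtain ⟨ζ, -, hx⟩ := mem_iUnion.1 hxE
    exact hx (key ζ hxA)
  rw [hAE, closure_empty] at h₁
  exact subset_empty_iff.1 h₁

/-- A family of sets that are pairwise at distance at least `δ` is locally finite. -/
lemma locallyFinite_of_le_dist {X ι : Type*} [PseudoMetricSpace X] {K : ι → Set X} {δ : ℝ}
    (hδ : 0 < δ) (h : ∀ i j, i ≠ j → ∀ x ∈ K i, ∀ y ∈ K j, δ ≤ dist x y) : LocallyFinite K := by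
  intro x
  refine ⟨Metric.ball x (δ / 2), Metric.ball_mem_nhds x (half_pos hδ), Set.Subsingleton.finite ?_⟩
  rintro i ⟨y, hy, hyx⟩ j ⟨z, hz, hzx⟩
  by_contra hij
  have h1 := h i j hij y hy z hz
  have h2 := dist_triangle_right y z x
  rw [Metric.mem_ball] at hyx hzx
  linarith

/-- The points at distance at least `1 / (n + 1)` from the complement of `V`. -/
def shrinking {X : Type*} [PseudoMetricSpace X] (V : Set X) (n : ℕ) : Set X :=
  {x | ∀ z ∉ V, 1 / ((n : ℝ) + 1) ≤ dist x z}

lemma isClosed_shrinking {X : Type*} [PseudoMetricSpace X] (V : Set X) (n : ℕ) :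
    IsClosed (shrinking V n) := by
  simp only [shrinking, ofPred_forall]
  exact isClosed_iInter fun z => isClosed_iInter fun _ =>
    isClosed_le continuous_const (continuous_id.dist continuous_const)

lemma shrinking_subset {X : Type*} [PseudoMetricSpace X] (V : Set X) (n : ℕ) :
    shrinking V n ⊆ V := by
  intro x hx
  by_contra hxV
  have h1 := hx x hxV
  rw [dist_self] at h1
  exact absurd h1 (not_le.2 Nat.one_div_pos_of_nat)

lemma IsOpen.exists_mem_shrinking {X : Type*} [PseudoMetricSpace X] {V : Set X} (hV : IsOpen V)
    {x : X} (hx : x ∈ V) : ∃ n, x ∈ shrinking V n := by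
  obtain ⟨ε, hε, hball⟩ := Metric.isOpen_iff.1 hV x hx
  obtain ⟨n, hn⟩ := exists_nat_one_div_lt hε
  refine ⟨n, fun z hz => ?_⟩
  by_contra hlt
  exact hz (hball (by rw [Metric.mem_ball']; linarith))

/-- Resolvable subsets of a metric space are countable unions of closed sets. -/
lemma IsResolvableSet.exists_iUnion_isClosed {X : Type u} [PseudoMetricSpace X] {E : Set X}
    (hE : IsResolvableSet E) : ∃ C : ℕ → Set X, (∀ n, IsClosed (C n)) ∧ E = ⋃ n, C n := by
  obtain ⟨F, hF, hcl, rfl⟩ := hE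
  have hlt : ∀ η ζ : Ordinal.{u}, η < ζ → F (2 * ζ) ⊆ F (2 * η + 1) := by
    intro η ζ h
    refine hF ?_
    rw [← Order.succ_eq_add_one, Order.succ_le_iff]
    exact mul_lt_mul_of_pos_left h two_pos
  have hsep : ∀ (n : ℕ) (η ζ : Ordinal.{u}), η < ζ →
      ∀ x ∈ F (2 * η) ∩ shrinking (F (2 * η + 1))ᶜ n,
      ∀ y ∈ F (2 * ζ) ∩ shrinking (F (2 * ζ + 1))ᶜ n, 1 / ((n : ℝ) + 1) ≤ dist x y :=
    fun n η ζ h x hx y hy => hx.2 y (not_not.2 (hlt η ζ h hy.1))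
  refine ⟨fun n => ⋃ η : Ordinal.{u}, F (2 * η) ∩ shrinking (F (2 * η + 1))ᶜ n, fun n => ?_, ?_⟩
  · refine (locallyFinite_of_le_dist (Nat.one_div_pos_of_nat (n := n)) ?_).isClosed_iUnion
      fun η => (hcl _).inter (isClosed_shrinking _ _)
    intro η ζ hne x hx y hy
    rcases lt_or_gt_of_ne hne with h | h
    · exact hsep n η ζ h x hx y hy
    · rw [dist_comm]
      exact hsep n ζ η h y hy x hx
  · ext x
    simp only [mem_iUnion]
    constructor
    · rintro ⟨η, h1, h2⟩
      obtain ⟨n, hn⟩ := (hcl (2 * η + 1)).isOpen_compl.exists_mem_shrinking h2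
      exact ⟨n, η, h1, hn⟩
    · rintro ⟨n, η, h1, h2⟩
      exact ⟨η, h1, shrinking_subset _ _ h2⟩

/-! ### The σ-ideal of sets covered by countably many closed sets of continuity -/

/-- `A` is covered by countably many closed sets on each of which `f` is continuous. -/
def SmallFor {X Y : Type*} [TopologicalSpace X] [TopologicalSpace Y] (f : X → Y) (A : Set X) :
    Prop :=
  ∃ C : ℕ → Set X, (∀ n, IsClosed (C n)) ∧ A ⊆ ⋃ n, C n ∧ ∀ n, ContinuousOn f (C n)

namespace SmallFor

variable {X Y : Type*} [TopologicalSpace Y] {f : X → Y} {A B : Set X}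

lemma mono [TopologicalSpace X] (hB : SmallFor f B) (h : A ⊆ B) : SmallFor f A :=
  let ⟨C, h1, h2, h3⟩ := hB
  ⟨C, h1, h.trans h2, h3⟩

lemma of_isClosed [TopologicalSpace X] (hA : IsClosed A) (h : ContinuousOn f A) : SmallFor f A :=
  ⟨fun _ => A, fun _ => hA, subset_iUnion (fun _ : ℕ => A) 0, fun _ => h⟩

lemma iUnion [TopologicalSpace X] {ι : Type*} [Countable ι] [Nonempty ι] {s : ι → Set X}
    (h : ∀ i, SmallFor f (s i)) : SmallFor f (⋃ i, s i) := by
  choose C h1 h2 h3 using h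
  obtain ⟨e, he⟩ := exists_surjective_nat (ι × ℕ)
  refine ⟨fun n => C (e n).1 (e n).2, fun n => h1 _ _, iUnion_subset fun i x hx => ?_,
    fun n => h3 _ _⟩
  obtain ⟨m, hm⟩ := mem_iUnion.1 (h2 i hx)
  obtain ⟨n, hn⟩ := he (i, m)
  exact mem_iUnion.2 ⟨n, by rw [hn]; exact hm⟩

lemma union [TopologicalSpace X] (hA : SmallFor f A) (hB : SmallFor f B) : SmallFor f (A ∪ B) := by
  rw [union_eq_iUnion]
  exact iUnion fun b => by cases b <;> assumption

/-- In a metric space, a set that is locally small is small. -/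
lemma of_locally [PseudoMetricSpace X]
    (h : ∀ x ∈ A, ∃ V, IsOpen V ∧ x ∈ V ∧ SmallFor f (V ∩ A)) : SmallFor f A := by
  choose! V hVo hxV C hC hcov hcont using h
  obtain ⟨_, _⟩ := exists_wellFoundedLT A
  let K : ℕ → ℕ → A → Set X := fun n m x =>
    (shrinking (V x) n ∩ (⋃ w : {w : A // w < x}, V w)ᶜ) ∩ C x m
  have hKcl : ∀ n m x, IsClosed (K n m x) := fun n m x =>
    ((isClosed_shrinking _ _).inter
      (isOpen_iUnion fun w => hVo _ w.1.2).isClosed_compl).inter (hC _ x.2 _)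
  have hsep : ∀ n m, ∀ v w : A, v < w → ∀ x ∈ K n m v, ∀ y ∈ K n m w,
      1 / ((n : ℝ) + 1) ≤ dist x y := by
    intro n m v w hvw x hx y hy
    refine hx.1.1 y fun hyv => hy.1.2 (mem_iUnion.2 ⟨⟨v, hvw⟩, hyv⟩)
  have hlf : ∀ n m, LocallyFinite (K n m) := by
    intro n m
    refine locallyFinite_of_le_dist (Nat.one_div_pos_of_nat (n := n)) ?_
    intro v w hne x hx y hy
    rcases lt_or_gt_of_ne hne with h | h
    · exact hsep n m v w h x hx y hy
    · rw [dist_comm]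
      exact hsep n m w v h y hy x hx
  have hsmall : SmallFor f (⋃ p : ℕ × ℕ, ⋃ x, K p.1 p.2 x) :=
    iUnion fun p => of_isClosed ((hlf _ _).isClosed_iUnion (hKcl _ _))
      ((hlf _ _).continuousOn_iUnion (hKcl _ _)
        fun x => (hcont _ x.2 _).mono inter_subset_right)
  refine hsmall.mono fun y hy => ?_
  have hne : {w : A | y ∈ V w}.Nonempty := ⟨⟨y, hy⟩, hxV y hy⟩
  obtain ⟨x, hyx, hmin⟩ := WellFounded.has_min (wellFounded_lt (α := A)) _ hne
  obtain ⟨n, hn⟩ := (hVo _ x.2).exists_mem_shrinking hyx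
  obtain ⟨m, hm⟩ := mem_iUnion.1 (hcov _ x.2 ⟨hyx, hy⟩)
  refine mem_iUnion.2 ⟨(n, m), mem_iUnion.2 ⟨x, ⟨hn, fun hmem => ?_⟩, hm⟩⟩
  obtain ⟨w, hw⟩ := mem_iUnion.1 hmem
  exact hmin w.1 hw w.2

end SmallFor

lemma SmallFor.piecewiseContinuous {X : Type u} {Y : Type v} [TopologicalSpace X]
    [TopologicalSpace Y] {f : X → Y} (h : SmallFor f univ) : PiecewiseContinuous f :=
  let ⟨C, h1, h2, h3⟩ := h
  ⟨C, h1, univ_subset_iff.1 h2, h3⟩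

/-! ### Points of irreducibility -/

/-- No neighbourhood of `x` meets `Z` in a set covered by countably many closed sets of
continuity of `f`. -/
def IrreducibleAt {X Y : Type*} [TopologicalSpace X] [TopologicalSpace Y] (f : X → Y) (Z : Set X)
    (x : X) : Prop :=
  ∀ V, IsOpen V → x ∈ V → ¬ SmallFor f (V ∩ Z)

lemma IrreducibleAt.mono {X Y : Type*} [TopologicalSpace X] [TopologicalSpace Y] {f : X → Y}
    {Z Z' : Set X} {x : X} (h : IrreducibleAt f Z x) (hZ : Z ⊆ Z') : IrreducibleAt f Z' x :=
  fun V hV hx hs => h V hV hx (hs.mono (inter_subset_inter_right V hZ))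

/-- If `x` is irreducible for a union, it is irreducible for one of the two sets. -/
lemma IrreducibleAt.or_of_union {X Y : Type*} [TopologicalSpace X] [TopologicalSpace Y] {f : X → Y}
    {Z Z' : Set X} {x : X} (h : IrreducibleAt f (Z ∪ Z') x) :
    IrreducibleAt f Z x ∨ IrreducibleAt f Z' x := by
  by_contra hcon
  simp only [IrreducibleAt, not_or, not_forall, not_not] at hcon
  obtain ⟨⟨V, hV, hxV, hs⟩, V', hV', hxV', hs'⟩ := hcon
  refine h (V ∩ V') (hV.inter hV') ⟨hxV, hxV'⟩ ((hs.union hs').mono ?_)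
  rintro y ⟨⟨h1, h2⟩, h3 | h3⟩
  · exact Or.inl ⟨h1, h3⟩
  · exact Or.inr ⟨h2, h3⟩

/-- A closed set that is not small contains a nonempty closed set that is nowhere locally small. -/
lemma exists_closed_irreducible {X Y : Type*} [PseudoMetricSpace X] [TopologicalSpace Y]
    {f : X → Y} {Z : Set X} (hZ : IsClosed Z) (h : ¬ SmallFor f Z) :
    ∃ K ⊆ Z, IsClosed K ∧ K.Nonempty ∧ ∀ x ∈ K, IrreducibleAt f K x := by
  let G : Set X := ⋃₀ {V | IsOpen V ∧ SmallFor f (V ∩ Z)}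
  have hG : IsOpen G := isOpen_sUnion fun V hV => hV.1
  have hsmall : SmallFor f (Z ∩ G) := by
    refine SmallFor.of_locally ?_
    rintro x ⟨-, V, ⟨hVo, hVs⟩, hxV⟩
    exact ⟨V, hVo, hxV, hVs.mono (inter_subset_inter_right V inter_subset_left)⟩
  have hirr : ∀ V : Set X, SmallFor f (V ∩ (Z \ G)) → SmallFor f (V ∩ Z) := fun V hV =>
    (hV.union hsmall).mono fun y hy => by
      by_cases hyG : y ∈ G
      · exact Or.inr ⟨hy.2, hyG⟩
      · exact Or.inl ⟨hy.1, hy.2, hyG⟩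
  refine ⟨Z \ G, sdiff_subset, hZ.sdiff hG, ?_, fun x hx V hV hxV hs => ?_⟩
  · by_contra hne
    rw [not_nonempty_iff_eq_empty, ← bot_eq_empty, sdiff_eq_bot_iff] at hne
    exact h (hsmall.mono fun y hy => ⟨hy, hne hy⟩)
  · exact hx.2 ⟨V, ⟨hV, hirr V hs⟩, hxV⟩

/-- On a nowhere locally small closed set `K` some point stays irreducible after the preimage of
a closed neighbourhood of its value is removed from `K`. -/
lemma exists_irreducibleAt_compl_closure {X Y : Type*} [TopologicalSpace X] [TopologicalSpace Y]
    [RegularSpace Y] {f : X → Y} {K : Set X} (hK : IsClosed K) (hne : K.Nonempty)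
    (hirr : ∀ x ∈ K, IrreducibleAt f K x) :
    ∃ x ∈ K, ∃ W, IsOpen W ∧ f x ∈ W ∧ IrreducibleAt f (K ∩ f ⁻¹' (closure W)ᶜ) x := by
  by_contra! hcon
  obtain ⟨x₀, hx₀⟩ := hne
  have hcont : ContinuousOn f K := by
    intro x hx N hN
    obtain ⟨T, hT, hTcl, hTN⟩ := exists_mem_nhds_isClosed_subset hN
    have h1 := hcon x hx (interior T) isOpen_interior (mem_interior_iff_mem_nhds.2 hT)
    simp only [IrreducibleAt, not_forall, not_not] at h1
    obtain ⟨V, hV, hxV, hs⟩ := h1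
    refine mem_nhdsWithin.2 ⟨V, hV, hxV, fun z hz => hTN ?_⟩
    by_contra hzT
    obtain ⟨T', hT', hTcl', hTT'⟩ :=
      exists_mem_nhds_isClosed_subset (hTcl.isOpen_compl.mem_nhds hzT)
    have h2 := hcon z hz.2 (interior T') isOpen_interior (mem_interior_iff_mem_nhds.2 hT')
    have h3 : IrreducibleAt f
        (K ∩ f ⁻¹' (closure (interior T))ᶜ ∪ K ∩ f ⁻¹' (closure (interior T'))ᶜ) z := by
      refine (hirr z hz.2).mono fun y hy => ?_
      by_cases hyT : f y ∈ closure (interior T)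
      · exact Or.inr ⟨hy, fun hyT' => hTT' (closure_minimal interior_subset hTcl' hyT')
          (closure_minimal interior_subset hTcl hyT)⟩
      · exact Or.inl ⟨hy, hyT⟩
    exact h3.or_of_union.resolve_right h2 V hV hz.1 hs
  exact hirr x₀ hx₀ univ isOpen_univ (mem_univ _)
    ((SmallFor.of_isClosed hK hcont).mono inter_subset_right)

/-- Given finitely many points irreducible outside of the preimage of a closed set `B`, and a
closed set `Z` that is not small outside of that preimage, there is a further point of `Z` whose
value has a neighbourhood away from `B` that can be added to `B`. -/
lemma ResolvableMeasurable.exists_irreducibleAt {X : Type u} {Y : Type v} [PseudoMetricSpace X]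
    [TopologicalSpace Y] [RegularSpace Y] {f : X → Y} (hf : ResolvableMeasurable f) {J : Set X}
    (hJ : J.Finite) : ∀ {B : Set Y}, IsClosed B → (∀ y ∈ J, IrreducibleAt f (f ⁻¹' Bᶜ) y) →
    ∀ {Z : Set X}, IsClosed Z → ¬ SmallFor f (Z ∩ f ⁻¹' Bᶜ) →
    ∃ x ∈ Z, ∃ W, IsOpen W ∧ f x ∈ W ∧ Disjoint (closure W) B ∧
      IrreducibleAt f (Z ∩ f ⁻¹' (B ∪ closure W)ᶜ) x ∧
      ∀ y ∈ J, IrreducibleAt f (f ⁻¹' (B ∪ closure W)ᶜ) y := by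
  induction J, hJ using Set.Finite.induction_on with
  | empty =>
    intro B hB _ Z hZ hns
    obtain ⟨C, hC, hCeq⟩ := (hf _ hB.isOpen_compl).exists_iUnion_isClosed
    have : ∃ n, ¬ SmallFor f (Z ∩ C n) := by
      by_contra! hcon
      refine hns ?_
      rw [hCeq, inter_iUnion]
      exact SmallFor.iUnion hcon
    obtain ⟨n, hn⟩ := this
    obtain ⟨K, hKZ, hKcl, hKne, hKirr⟩ := exists_closed_irreducible (hZ.inter (hC n)) hn
    have hKB : K ⊆ f ⁻¹' Bᶜ := fun y hy => by
      rw [hCeq]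
      exact mem_iUnion.2 ⟨n, (hKZ hy).2⟩
    obtain ⟨x, hxK, W, hW, hxW, hx⟩ := exists_irreducibleAt_compl_closure hKcl hKne hKirr
    obtain ⟨T, hT, hTcl, hTB⟩ := exists_mem_nhds_isClosed_subset
      (hB.isOpen_compl.mem_nhds (hKB hxK))
    have hcl : closure (W ∩ interior T) ⊆ Bᶜ :=
      (closure_minimal (inter_subset_right.trans interior_subset) hTcl).trans hTB
    refine ⟨x, (hKZ hxK).1, W ∩ interior T, hW.inter isOpen_interior,
      ⟨hxW, mem_interior_iff_mem_nhds.2 hT⟩, subset_compl_iff_disjoint_right.1 hcl,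
      hx.mono ?_, by simp⟩
    rintro y ⟨hyK, hyW⟩
    refine ⟨(hKZ hyK).1, ?_⟩
    rintro (h | h)
    · exact hKB hyK h
    · exact hyW (closure_mono inter_subset_left h)
  | @insert a J _ _ ih =>
    intro B hB hirr Z hZ hns
    obtain ⟨x, hxZ, W, hW, hxW, hdisj, hx, hJW⟩ :=
      ih hB (fun y hy => hirr y (mem_insert_of_mem a hy)) hZ hns
    by_cases ha : IrreducibleAt f (f ⁻¹' (B ∪ closure W)ᶜ) a
    · refine ⟨x, hxZ, W, hW, hxW, hdisj, hx, ?_⟩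
      rintro y (rfl | hy)
      exacts [ha, hJW y hy]
    obtain ⟨x', hxZ', W', hW', hxW', hdisj', hx', hJW'⟩ :=
      ih (hB.union isClosed_closure) hJW hZ
        fun hs => hx univ isOpen_univ (mem_univ _) (hs.mono inter_subset_right)
    have hsub : (B ∪ closure W ∪ closure W')ᶜ ⊆ (B ∪ closure W')ᶜ :=
      compl_subset_compl.2 (union_subset_union_left _ subset_union_left)
    refine ⟨x', hxZ', W', hW', hxW', hdisj'.mono_right subset_union_left,
      hx'.mono (inter_subset_inter_right _ (preimage_mono hsub)), ?_⟩
    rintro y (rfl | hy)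
    · refine (IrreducibleAt.or_of_union ((hirr y (mem_insert y J)).mono ?_)).resolve_left ha
      intro z hz
      by_cases hzW : f z ∈ closure W
      · refine Or.inr ?_
        rintro (h | h)
        · exact hz h
        · exact disjoint_left.1 hdisj' h (Or.inr hzW)
      · refine Or.inl ?_
        rintro (h | h)
        exacts [hz h, hzW h]
    · exact (hJW' y hy).mono (preimage_mono hsub)

/-! ### Construction of a dense and codense set -/

/-- Two finite sets of points with disjoint open neighbourhoods of their images, such that every
point is irreducible outside of the preimage of the closure of these neighbourhoods. -/
structure SplitApprox {X Y : Type*} [TopologicalSpace X] [TopologicalSpace Y] (f : X → Y) where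
  P : Set X
  Q : Set X
  U : Set Y
  V : Set Y
  finite_P : P.Finite
  finite_Q : Q.Finite
  isOpen_U : IsOpen U
  isOpen_V : IsOpen V
  mapsTo_P : MapsTo f P U
  mapsTo_Q : MapsTo f Q V
  disjoint : Disjoint U V
  irreducibleAt : ∀ x ∈ P ∪ Q, IrreducibleAt f (f ⁻¹' (closure (U ∪ V))ᶜ) x

namespace SplitApprox

variable {X : Type u} {Y : Type v} [TopologicalSpace Y] {f : X → Y}

/-- `t` extends `s`. -/
def Extends [TopologicalSpace X] (s t : SplitApprox f) : Prop :=
  s.P ⊆ t.P ∧ s.Q ⊆ t.Q ∧ s.U ⊆ t.U ∧ s.V ⊆ t.V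

lemma Extends.refl [TopologicalSpace X] (s : SplitApprox f) : s.Extends s :=
  ⟨Subset.rfl, Subset.rfl, Subset.rfl, Subset.rfl⟩

lemma Extends.trans [TopologicalSpace X] {s t r : SplitApprox f} (h : s.Extends t)
    (h' : t.Extends r) : s.Extends r :=
  ⟨h.1.trans h'.1, h.2.1.trans h'.2.1, h.2.2.1.trans h'.2.2.1, h.2.2.2.trans h'.2.2.2⟩

/-- Exchange of the two sides. -/
def swap [TopologicalSpace X] (s : SplitApprox f) : SplitApprox f where
  P := s.Q
  Q := s.P
  U := s.V
  V := s.U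
  finite_P := s.finite_Q
  finite_Q := s.finite_P
  isOpen_U := s.isOpen_V
  isOpen_V := s.isOpen_U
  mapsTo_P := s.mapsTo_Q
  mapsTo_Q := s.mapsTo_P
  disjoint := s.disjoint.symm
  irreducibleAt := by
    rw [union_comm s.Q, union_comm s.V]
    exact s.irreducibleAt

variable [PseudoMetricSpace X] [RegularSpace Y]

lemma exists_add_point (hf : ResolvableMeasurable f) (s : SplitApprox f) {Z : Set X}
    (hZ : IsClosed Z) (hns : ¬ SmallFor f (Z ∩ f ⁻¹' (closure (s.U ∪ s.V))ᶜ)) :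
    ∃ t : SplitApprox f, s.Extends t ∧ (t.P ∩ Z).Nonempty := by
  obtain ⟨x, hxZ, W, hW, hxW, hdisj, hx, hirr⟩ := hf.exists_irreducibleAt
    (s.finite_P.union s.finite_Q) isClosed_closure s.irreducibleAt hZ hns
  have hcl : closure (s.U ∪ W ∪ s.V) = closure (s.U ∪ s.V) ∪ closure W := by
    rw [← closure_union, union_right_comm]
  refine ⟨{
    P := insert x s.P
    Q := s.Q
    U := s.U ∪ W
    V := s.V
    finite_P := s.finite_P.insert x
    finite_Q := s.finite_Q
    isOpen_U := s.isOpen_U.union hW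
    isOpen_V := s.isOpen_V
    mapsTo_P := ?_
    mapsTo_Q := s.mapsTo_Q
    disjoint := ?_
    irreducibleAt := ?_ },
    ⟨subset_insert _ _, Subset.rfl, subset_union_left, Subset.rfl⟩, x, mem_insert _ _, hxZ⟩
  · rintro y (rfl | hy)
    exacts [Or.inr hxW, Or.inl (s.mapsTo_P hy)]
  · exact disjoint_union_left.2 ⟨s.disjoint, hdisj.mono subset_closure
      (subset_union_right.trans subset_closure)⟩
  · rw [hcl]
    rintro y ((rfl | hy) | hy)
    exacts [hx.mono inter_subset_right, hirr y (Or.inl hy), hirr y (Or.inr hy)]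

lemma exists_approx_P (hf : ResolvableMeasurable f) {ε : ℝ} (hε : 0 < ε) (s : SplitApprox f)
    {T : Set X} (hT : T.Finite) (hTs : T ⊆ s.P ∪ s.Q) :
    ∃ t : SplitApprox f, s.Extends t ∧ ∀ x ∈ T, ∃ y ∈ t.P, dist y x ≤ ε := by
  induction T, hT using Set.Finite.induction_on with
  | empty => exact ⟨s, .refl s, by simp⟩
  | @insert a T _ _ ih =>
    obtain ⟨t, hst, ht⟩ := ih ((subset_insert a T).trans hTs)
    have ha : a ∈ t.P ∪ t.Q := union_subset_union hst.1 hst.2.1 (hTs (mem_insert a T))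
    obtain ⟨r, htr, y, hy, hya⟩ := t.exists_add_point hf (Z := Metric.closedBall a ε)
      Metric.isClosed_closedBall fun hs =>
        t.irreducibleAt a ha _ Metric.isOpen_ball (Metric.mem_ball_self hε)
          (hs.mono (inter_subset_inter_left _ Metric.ball_subset_closedBall))
    refine ⟨r, hst.trans htr, ?_⟩
    rintro x (rfl | hx)
    · exact ⟨y, hy, hya⟩
    · obtain ⟨z, hz, hzx⟩ := ht x hx
      exact ⟨z, htr.1 hz, hzx⟩

lemma exists_approx (hf : ResolvableMeasurable f) {ε : ℝ} (hε : 0 < ε) (s : SplitApprox f) :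
    ∃ t : SplitApprox f, s.Extends t ∧
      ∀ x ∈ s.P ∪ s.Q, (∃ y ∈ t.P, dist y x ≤ ε) ∧ ∃ y ∈ t.Q, dist y x ≤ ε := by
  have hfin := s.finite_P.union s.finite_Q
  obtain ⟨t, hst, ht⟩ := s.exists_approx_P hf hε hfin Subset.rfl
  obtain ⟨r, htr, hr⟩ := t.swap.exists_approx_P hf hε hfin
    ((union_subset_union hst.1 hst.2.1).trans (union_comm _ _).subset)
  refine ⟨r.swap, hst.trans ⟨htr.2.1, htr.1, htr.2.2.2, htr.2.2.1⟩, fun x hx => ⟨?_, hr x hx⟩⟩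
  obtain ⟨y, hy, hyx⟩ := ht x hx
  exact ⟨y, htr.2.1 hy, hyx⟩

end SplitApprox

theorem theorem4 {X : Type u} {Y : Type v} [TopologicalSpace X] [TopologicalSpace Y]
    [TopologicalSpace.MetrizableSpace X] [RegularSpace Y] (f : X → Y)
    (hf : ResolvableMeasurable f) : PiecewiseContinuous f := by
  let _ := TopologicalSpace.metrizableSpaceMetric X
  by_contra hpc
  have hns : ¬ SmallFor f univ := fun h => hpc h.piecewiseContinuous
  let bot : SplitApprox f :=
    { P := ∅, Q := ∅, U := ∅, V := ∅, finite_P := finite_empty, finite_Q := finite_empty,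
      isOpen_U := isOpen_empty, isOpen_V := isOpen_empty, mapsTo_P := mapsTo_empty _ _,
      mapsTo_Q := mapsTo_empty _ _, disjoint := disjoint_bot_left, irreducibleAt := by simp }
  obtain ⟨s₀, -, x₀, hx₀, -⟩ := bot.exists_add_point hf isClosed_univ (by simpa [bot] using hns)
  choose next hext hnext using fun (n : ℕ) (s : SplitApprox f) =>
    s.exists_approx hf (Nat.one_div_pos_of_nat (α := ℝ) (n := n))
  let s : ℕ → SplitApprox f := fun n => Nat.rec s₀ next n
  have hmono : ∀ {m n}, m ≤ n → (s m).Extends (s n) := by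
    intro m n h
    induction n, h using Nat.le_induction with
    | base => exact .refl _
    | succ n _ ih => exact ih.trans (hext n (s n))
  have hdisj : ∀ m n, Disjoint (s m).U (s n).V := fun m n =>
    (s (max m n)).disjoint.mono (hmono (le_max_left m n)).2.2.1 (hmono (le_max_right m n)).2.2.2
  set A : Set X := ⋃ n, (s n).P ∪ (s n).Q with hA
  set O : Set Y := ⋃ n, (s n).U with hO
  have hPA : ∀ n, (s n).P ⊆ A ∩ f ⁻¹' O := fun n x hx =>
    ⟨mem_iUnion.2 ⟨n, Or.inl hx⟩, mem_iUnion.2 ⟨n, (s n).mapsTo_P hx⟩⟩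
  have hQA : ∀ n, (s n).Q ⊆ A \ f ⁻¹' O := fun n x hx =>
    ⟨mem_iUnion.2 ⟨n, Or.inr hx⟩, fun hxO => by
      obtain ⟨m, hm⟩ := mem_iUnion.1 hxO
      exact disjoint_left.1 (hdisj m n) hm ((s n).mapsTo_Q hx)⟩
  have happrox : ∀ x ∈ A, ∀ ε > 0, ∃ n, (∃ y ∈ (s n).P, dist x y < ε) ∧
      ∃ y ∈ (s n).Q, dist x y < ε := by
    intro x hx ε hε
    obtain ⟨m, hm⟩ := mem_iUnion.1 hx
    obtain ⟨k, hk⟩ := exists_nat_one_div_lt hε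
    have hle := hmono (le_max_left m k)
    have hkε : 1 / (((max m k : ℕ) : ℝ) + 1) < ε :=
      (Nat.one_div_le_one_div (le_max_right m k)).trans_lt hk
    obtain ⟨⟨y, hy, hyx⟩, z, hz, hzx⟩ :=
      hnext (max m k) (s (max m k)) x (union_subset_union hle.1 hle.2.1 hm)
    rw [dist_comm] at hyx hzx
    exact ⟨max m k + 1, ⟨y, hy, hyx.trans_lt hkε⟩, z, hz, hzx.trans_lt hkε⟩
  have hempty : A = ∅ := by
    refine (hf O (isOpen_iUnion fun n => (s n).isOpen_U)).eq_empty_of_dense_codense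
      (fun x hx => Metric.mem_closure_iff.2 fun ε hε => ?_)
      (fun x hx => Metric.mem_closure_iff.2 fun ε hε => ?_)
    · obtain ⟨n, ⟨y, hy, hyx⟩, -⟩ := happrox x hx ε hε
      exact ⟨y, hPA n hy, hyx⟩
    · obtain ⟨n, -, y, hy, hyx⟩ := happrox x hx ε hε
      exact ⟨y, hQA n hy, hyx⟩
  exact (hempty ▸ (mem_iUnion.2 ⟨0, Or.inl hx₀⟩ : x₀ ∈ A) : x₀ ∈ (∅ : Set X))
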